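/- The trace norm $\|A\|_*$ of a real matrix $A$ is the sum of its singular values. For positive integers $n$ and $m$ with $m\le n^2$, let $\psi_n(m)$ be the minimum of $\|A\|_*$ over all $n\times n$ matrices $A$ with entries in $\{0,1\}$ and exactly $m$ entries equal to $1$. **Theorem.** Let $n\ge 4$ and $2n<m\le 3n$ be integers. If $m$ is a prime or twice a prime, then $$\psi_n(m)=\sqrt{m+2\sqrt{2\lfloor m/3\rfloor}};$$ otherwise $\psi_n(m)=\sqrt{m}$. -/

import Mathlib

/-- The trace norm of a real `p × q` matrix: the sum of its singular values.  The singular values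
are those of the linear map `ℝ^q → ℝ^p`, `x ↦ A x`, between Euclidean spaces, listed in decreasing
order with multiplicity; those with index at least `min p q` are zero. -/
noncomputable def traceNorm {p q : ℕ} (A : Matrix (Fin p) (Fin q) ℝ) : ℝ :=
  ∑ i ∈ Finset.range q, (Matrix.toEuclideanLin A).singularValues i

/-- The set of `n × n` matrices with all entries in `{0, 1}` and exactly `m` entries equal to `1`. -/
def zeroOneMatrices (n m : ℕ) : Set (Matrix (Fin n) (Fin n) ℝ) :=
  {A | (∀ i j, A i j = 0 ∨ A i j = 1) ∧ {e : Fin n × Fin n | A e.1 e.2 = 1}.ncard = m}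

/-- The minimum trace norm of an `n × n` matrix with entries in `{0, 1}` and exactly `m` ones.
It is a true minimum whenever `m ≤ n ^ 2`, see `minTraceNorm_isLeast`. -/
noncomputable def minTraceNorm (n m : ℕ) : ℝ :=
  sInf (traceNorm '' zeroOneMatrices n m)

theorem zeroOneMatrices_finite (n m : ℕ) : (zeroOneMatrices n m).Finite := by
  have h : (Set.pi Set.univ fun _ : Fin n => Set.pi Set.univ fun _ : Fin n =>
      ({0, 1} : Set ℝ)).Finite :=
    Set.Finite.pi fun _ => Set.Finite.pi fun _ => Set.toFinite _
  refine h.subset fun A hA i _ j _ => ?_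
  simpa using hA.1 i j

theorem zeroOneMatrices_nonempty {n m : ℕ} (h : m ≤ n ^ 2) : (zeroOneMatrices n m).Nonempty := by
  classical
  have hc : m ≤ (Finset.univ : Finset (Fin n × Fin n)).card := by
    simpa [sq] using h
  obtain ⟨s, -, hs⟩ := Finset.exists_subset_card_eq hc
  refine ⟨fun i j => if (i, j) ∈ s then 1 else 0, fun i j => ?_, ?_⟩
  · by_cases hij : (i, j) ∈ s <;> simp [hij]
  · have : {e : Fin n × Fin n | (if (e.1, e.2) ∈ s then (1 : ℝ) else 0) = 1} = (s : Set _) := by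
      ext e
      simp
    rw [this, Set.ncard_coe_finset, hs]

theorem minTraceNorm_isLeast {n m : ℕ} (h : m ≤ n ^ 2) :
    IsLeast (traceNorm '' zeroOneMatrices n m) (minTraceNorm n m) := by
  have hf := (zeroOneMatrices_finite n m).image traceNorm
  exact ⟨((zeroOneMatrices_nonempty h).image traceNorm).csInf_mem hf,
    fun x hx => csInf_le hf.bddBelow hx⟩

/-! Let `σ i` be the singular values. Then `∑ σ i ^ 2 = m`, so the squared trace norm is `m + 2e`,
where `e` is the sum of `σ i * σ j` over `i < j`. Moreover `e ^ 2 ≥ d`, where `d` is the sum of `σ i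
^ 2 * σ j ^ 2` over `i < j`, with equality in rank at most two. By Cauchy–Binet `d` is the sum of
the squared `2 × 2` minors; for a `0-1` matrix it is the number of nonzero minors, so the problem is
to minimise that number.

If `m` is neither prime nor twice a prime, then `m = a * b` with `a, b ≤ n`, and an all-ones block
has `d = 0`. Otherwise no such factorisation exists, and `four_mul_div_three_le_sum_minorCount`
gives `d ≥ 2 * (m / 3)`. If every nonempty column differs from at least two other nonempty ones,
summing a bound on each pair gives `2d ≥ 2m - n > 3m / 2`. If not, all nonempty columns but one
coincide, which leaves the arithmetic of `two_mul_div_three_le`. Equality holds for `m / 3` equal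
columns with three ones and one column inside them holding the remainder; this has rank two. -/

open Finset

/-! ### Trace norm and the traces of powers of the Gram matrix -/

theorem toEuclideanLin_eq_toLin_basisFun {p q : ℕ} (A : Matrix (Fin p) (Fin q) ℝ) :
    Matrix.toEuclideanLin A =
      Matrix.toLin (PiLp.basisFun 2 ℝ (Fin q)) (PiLp.basisFun 2 ℝ (Fin p)) A := by
  rw [← Matrix.toLpLin_eq_toLin]

theorem sum_sq_singularValues {p q : ℕ} (A : Matrix (Fin p) (Fin q) ℝ) :
    ∑ i ∈ range q, (Matrix.toEuclideanLin A).singularValues i ^ 2 = (A.transpose * A).trace ∧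
    ∑ i ∈ range q, (Matrix.toEuclideanLin A).singularValues i ^ 4 =
      (A.transpose * A * (A.transpose * A)).trace := by
  set T := Matrix.toEuclideanLin A with hT
  have hq : Module.finrank ℝ (EuclideanSpace ℝ (Fin q)) = q := by simp
  have hS := T.isSymmetric_adjoint_comp_self
  set b := (hS.eigenvectorBasis hq).toBasis with hb
  set e := (PiLp.basisFun 2 ℝ (Fin q)) with he
  have h1 : LinearMap.toMatrix b b (T.adjoint ∘ₗ T) =
      Matrix.diagonal (hS.eigenvalues hq) := hS.toMatrix_eigenvectorBasis hq
  have h2 : LinearMap.toMatrix e e (T.adjoint ∘ₗ T) = A.transpose * A := by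
    rw [hT, ← Matrix.toEuclideanLin_conjTranspose_eq_adjoint, toEuclideanLin_eq_toLin_basisFun,
      toEuclideanLin_eq_toLin_basisFun, ← Matrix.toLin_mul, LinearMap.toMatrix_toLin,
      Matrix.conjTranspose_eq_transpose_of_trivial]
  constructor
  · rw [← h2, ← LinearMap.trace_eq_matrix_trace, LinearMap.trace_eq_matrix_trace ℝ b, h1,
      Matrix.trace_diagonal, ← Fin.sum_univ_eq_sum_range (fun i => T.singularValues i ^ 2)]
    exact sum_congr rfl fun i _ => T.sq_singularValues_fin hq i
  · rw [← h2, ← LinearMap.toMatrix_mul, ← LinearMap.trace_eq_matrix_trace,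
      LinearMap.trace_eq_matrix_trace ℝ b, LinearMap.toMatrix_mul, h1, Matrix.diagonal_mul_diagonal,
      Matrix.trace_diagonal, ← Fin.sum_univ_eq_sum_range (fun i => T.singularValues i ^ 4)]
    refine sum_congr rfl fun i _ => ?_
    rw [← T.sq_singularValues_fin hq i]
    ring

/-- The second inequality is four times the comparison of `∑ (x i * x j) ^ 2` with `(∑ x i * x j) ^
2`, over pairs `i < j`. Its induction step needs the first. -/
theorem sq_sum_sub_sq_ge {ι : Type*} (s : Finset ι) (x : ι → ℝ) (hx : ∀ i, 0 ≤ x i) :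
    ∑ i ∈ s, x i ^ 2 ≤ (∑ i ∈ s, x i) ^ 2 ∧
    2 * ((∑ i ∈ s, x i ^ 2) ^ 2 - ∑ i ∈ s, x i ^ 4) ≤
      ((∑ i ∈ s, x i) ^ 2 - ∑ i ∈ s, x i ^ 2) ^ 2 := by
  classical
  induction s using Finset.induction_on with
  | empty => simp
  | insert a s ha ih =>
    simp only [sum_insert ha]
    obtain ⟨h1, h2⟩ := ih
    have h0 : 0 ≤ ∑ i ∈ s, x i := sum_nonneg fun i _ => hx i
    have ha0 := hx a
    set p := ∑ i ∈ s, x i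
    set u := ∑ i ∈ s, x i ^ 2
    set v := ∑ i ∈ s, x i ^ 4
    have h3 : 0 ≤ x a * p * (p ^ 2 - u) := by
      have := sub_nonneg.2 h1
      positivity
    have h4 : 0 ≤ x a ^ 2 * (p ^ 2 - u) := by
      have := sub_nonneg.2 h1
      positivity
    constructor
    · nlinarith [mul_nonneg ha0 h0]
    · nlinarith

theorem traceNorm_nonneg {p q : ℕ} (A : Matrix (Fin p) (Fin q) ℝ) : 0 ≤ traceNorm A :=
  sum_nonneg fun i _ => LinearMap.singularValues_nonneg _ i

theorem le_traceNorm {p q : ℕ} (A : Matrix (Fin p) (Fin q) ℝ) {m d : ℝ}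
    (hm : (A.transpose * A).trace = m)
    (hd : (A.transpose * A * (A.transpose * A)).trace ≤ m ^ 2 - 2 * d) :
    √(m + 2 * √d) ≤ traceNorm A := by
  obtain ⟨h1, h2⟩ := sum_sq_singularValues A
  obtain ⟨h3, h4⟩ := sq_sum_sub_sq_ge (range q) (Matrix.toEuclideanLin A).singularValues
    (LinearMap.singularValues_nonneg _)
  change _ ≤ traceNorm A ^ 2 at h3
  change _ ≤ (traceNorm A ^ 2 - _) ^ 2 at h4
  rw [h1, hm] at h3 h4
  rw [h2] at h4
  refine Real.sqrt_le_iff.2 ⟨traceNorm_nonneg A, ?_⟩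
  have : √d ≤ (traceNorm A ^ 2 - m) / 2 := by
    refine Real.sqrt_le_iff.2 ⟨by linarith, ?_⟩
    nlinarith
  linarith

theorem traceNorm_eq_of_rank_le_two {p q : ℕ} (A : Matrix (Fin p) (Fin q) ℝ) {m d : ℝ}
    (hm : (A.transpose * A).trace = m)
    (hd : (A.transpose * A * (A.transpose * A)).trace = m ^ 2 - 2 * d)
    (hr : A.rank ≤ 2) (hq : 2 ≤ q) :
    traceNorm A = √(m + 2 * √d) := by
  obtain ⟨h1, h2⟩ := sum_sq_singularValues A
  set T := Matrix.toEuclideanLin A with hT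
  have hz : ∀ i, 2 ≤ i → T.singularValues i = 0 := fun i hi => by
    refine T.singularValues_eq_zero_iff_le_finrank_range.2 (le_trans ?_ hi)
    rwa [hT, toEuclideanLin_eq_toLin_basisFun, ← Matrix.rank_eq_finrank_range_toLin]
  have hsum : ∀ g : ℕ → ℝ, (∀ i, 2 ≤ i → g i = 0) → ∑ i ∈ range q, g i = g 0 + g 1 := by
    intro g hg
    rw [← sum_range_add_sum_Ico g hq, sum_range_succ, sum_range_one,
      sum_eq_zero fun i hi => hg i (mem_Ico.1 hi).1, add_zero]
  rw [hsum _ fun i hi => by simp [hz i hi], hm] at h1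
  rw [hsum _ fun i hi => by simp [hz i hi], hd] at h2
  have h3 : traceNorm A = T.singularValues 0 + T.singularValues 1 := hsum _ hz
  have h0 := T.singularValues_nonneg 0
  have h0' := T.singularValues_nonneg 1
  have h4 : √d = T.singularValues 0 * T.singularValues 1 := by
    have : d = (T.singularValues 0 * T.singularValues 1) ^ 2 := by
      rw [← h1] at h2
      linear_combination (1 / 2) * h2
    rw [this, Real.sqrt_sq (mul_nonneg h0 h0')]
  have h5 : m + 2 * √d = (T.singularValues 0 + T.singularValues 1) ^ 2 := by
    rw [h4, ← h1]
    ring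
  rw [h3, h5, Real.sqrt_sq (add_nonneg h0 h0')]

/-! ### Arithmetic of matrices with two distinct nonempty columns -/

/-- Here `M` columns have support `s` and one has support `t`; `a`, `b`, `c` are the sizes of `s \
t`, `t \ s`, `s ∩ t`. The right side counts the nonzero minors. -/
theorem two_mul_div_three_le {n m M a b c : ℕ} (hm : m = M * (a + c) + (b + c)) (hn : 2 * n < m)
    (hM : M + 1 ≤ n) (habc : a + b + c ≤ n) (h3 : ¬ 3 ∣ m) (hab : 0 < a + b) (hbc : 0 < b + c)
    (hac : 0 < a + c) :
    2 * (m / 3) ≤ M * (a * b + a * c + b * c) := by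
  have hM2 : 2 ≤ M := by
    by_contra! h
    interval_cases M <;> omega
  -- As `3 ∤ m`, rounding gains at least `2 / 3`, so `2m ≤ 3d + 2` suffices.
  have key : 2 * (M * (a + c) + (b + c)) ≤ 3 * (M * (a * b + a * c + b * c)) + 2 →
      2 * (m / 3) ≤ M * (a * b + a * c + b * c) := by
    rw [← hm]; omega
  obtain ⟨N, rfl⟩ := Nat.exists_eq_add_of_le hM2
  rcases Nat.eq_zero_or_pos a with rfl | ha
  · apply key
    obtain ⟨b, rfl⟩ := Nat.exists_eq_add_of_le' (show 1 ≤ b by omega)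
    obtain ⟨c, rfl⟩ := Nat.exists_eq_add_of_le' (show 1 ≤ c by omega)
    rcases Nat.eq_zero_or_pos b with rfl | hb
    · nlinarith [Nat.zero_le (N * c)]
    · obtain ⟨b, rfl⟩ := Nat.exists_eq_add_of_le' hb
      ring_nf; nlinarith [Nat.zero_le (N * c), Nat.zero_le (b * c), Nat.zero_le (N * b * c)]
  obtain ⟨a, rfl⟩ := Nat.exists_eq_add_of_le' ha
  rcases Nat.eq_zero_or_pos b with rfl | hb
  · obtain ⟨c, rfl⟩ := Nat.exists_eq_add_of_le' (show 1 ≤ c by omega)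
    rcases Nat.eq_zero_or_pos c with rfl | hc
    · rcases Nat.eq_zero_or_pos a with rfl | ha
      -- Here `m = 2 * M + 1 < 2 * n`, a contradiction.
      · omega
      · obtain ⟨a, rfl⟩ := Nat.exists_eq_add_of_le' ha
        apply key
        nlinarith [Nat.zero_le (N * a)]
    · obtain ⟨c, rfl⟩ := Nat.exists_eq_add_of_le' hc
      rcases Nat.eq_zero_or_pos a with rfl | ha
      -- For `a = 1`, `b = 0` and `M = 2` or `c = 2`, the bound is an equality and `key` is too
      -- weak.
      · rcases Nat.eq_zero_or_pos N with rfl | hN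
        · omega
        rcases Nat.eq_zero_or_pos c with rfl | hc
        · omega
        obtain ⟨N, rfl⟩ := Nat.exists_eq_add_of_le' hN
        obtain ⟨c, rfl⟩ := Nat.exists_eq_add_of_le' hc
        apply key
        rcases Nat.eq_zero_or_pos N with rfl | hN
        · rcases Nat.eq_zero_or_pos c with rfl | hc
          -- `M = c = 3` gives `m = 15` and `d = 9 < 10`; only `3 ∤ m` excludes it.
          · omega
          · nlinarith
        · nlinarith [Nat.zero_le (N * c)]
      · obtain ⟨a, rfl⟩ := Nat.exists_eq_add_of_le' ha
        apply key
        ring_nf; nlinarith [Nat.zero_le (N * a), Nat.zero_le (N * c), Nat.zero_le (a * c),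
          Nat.zero_le (N * a * c)]
  · obtain ⟨b, rfl⟩ := Nat.exists_eq_add_of_le' hb
    apply key
    ring_nf; nlinarith [Nat.zero_le (N * a), Nat.zero_le (N * c), Nat.zero_le (a * c),
      Nat.zero_le (N * a * c), Nat.zero_le (N * b * c), Nat.zero_le (N * a * b),
      Nat.zero_le (b * c), Nat.zero_le (a * b), Nat.zero_le (N * b)]

/-! ### Counting nonzero minors -/

/-- The number of nonzero `2 × 2` minors of the two-column `0-1` matrix with column supports
`s` and `t`. -/
def minorCount {α : Type*} [DecidableEq α] (s t : Finset α) : ℤ :=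
  #s * #t - (#(s ∩ t) : ℤ) ^ 2

section
variable {α : Type*} [DecidableEq α] (s t : Finset α)

theorem minorCount_comm : minorCount s t = minorCount t s := by
  rw [minorCount, minorCount, inter_comm, mul_comm]

/-- A minor is nonzero exactly when its two rows are distinct and nonzero, that is, lie in different
classes among `s \ t`, `t \ s`, `s ∩ t`. -/
theorem minorCount_eq : minorCount s t =
    (#(s \ t) * #(t \ s) + #(s \ t) * #(s ∩ t) + #(t \ s) * #(s ∩ t) : ℕ) := by
  have h1 := card_sdiff_add_card_inter s t
  have h2 := card_sdiff_add_card_inter t s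
  rw [inter_comm] at h2
  rw [minorCount, ← h1, ← h2]
  push_cast
  ring

theorem minorCount_nonneg : 0 ≤ minorCount s t := by
  rw [minorCount_eq]
  positivity

variable {s t} in
theorem card_add_card_le_minorCount (hs : s.Nonempty) (ht : t.Nonempty) (hst : s ≠ t) :
    (#s + #t - 1 : ℤ) ≤ 2 * minorCount s t := by
  have h1 := card_sdiff_add_card_inter s t
  have h2 := card_sdiff_add_card_inter t s
  have h3 : 0 < #(s \ t) + #(t \ s) := by
    by_contra! h
    apply hst
    apply Subset.antisymm <;> rw [← sdiff_eq_empty_iff_subset, ← card_eq_zero] <;> omega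
  have hs := hs.card_pos
  have ht := ht.card_pos
  rw [inter_comm] at h2
  rw [minorCount_eq, ← h1, ← h2]
  rw [← h1] at hs
  rw [← h2] at ht
  generalize #(s \ t) = a, #(t \ s) = b, #(s ∩ t) = c at *
  push_cast
  zify at hs ht h3
  rcases Nat.eq_zero_or_pos a with rfl | ha
  · simp at *
    nlinarith
  · rcases Nat.eq_zero_or_pos b with rfl | hb
    · simp at *
      nlinarith
    · zify at ha hb
      have hc : (0 : ℤ) ≤ c := by positivity
      nlinarith
end

section
variable {ι α : Type*} [Fintype ι] [DecidableEq α]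

/-- Summing `card_add_card_le_minorCount` over ordered pairs of distinct nonempty columns, symmetry
gives column `i` the weight `2 * #(f i) - 1` at least twice. -/
theorem sum_card_le_sum_minorCount (f : ι → Finset α)
    (h : ∀ i, (f i).Nonempty → 2 ≤ #{j | (f j).Nonempty ∧ f j ≠ f i}) :
    4 * ∑ i, (#(f i) : ℤ) - 2 * Fintype.card ι ≤ 2 * ∑ i, ∑ j, minorCount (f i) (f j) := by
  let V : Finset ι := {i | (f i).Nonempty}
  have hV : ∀ i, i ∈ V ↔ (f i).Nonempty := fun i => by simp [V]
  have hW : ∀ i, (({j | (f j).Nonempty ∧ f j ≠ f i} : Finset ι)) = V.filter (f · ≠ f i) :=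
    fun i => by simp [V, filter_filter]
  simp only [hW] at h
  have h1 : ∑ i, (#(f i) : ℤ) = ∑ i ∈ V, (#(f i) : ℤ) := by
    refine (sum_subset (subset_univ V) fun i _ hi => ?_).symm
    simpa [hV] using hi
  have h2 : ∑ i ∈ V, ∑ j ∈ V with f j ≠ f i, (#(f i) + #(f j) - 1 : ℤ) ≤
      2 * ∑ i, ∑ j, minorCount (f i) (f j) := by
    simp only [mul_sum]
    refine (sum_le_sum fun i hi => ?_).trans (sum_le_sum_of_subset_of_nonneg (subset_univ V)
      fun i _ _ => sum_nonneg fun j _ => mul_nonneg zero_le_two (minorCount_nonneg _ _))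
    refine (sum_le_sum fun j hj => ?_).trans (sum_le_sum_of_subset_of_nonneg (subset_univ _)
      fun j _ _ => mul_nonneg zero_le_two (minorCount_nonneg _ _))
    rw [mem_filter] at hj
    exact card_add_card_le_minorCount ((hV i).1 hi) ((hV j).1 hj.1) hj.2.symm
  have h3 : ∑ i ∈ V, ∑ j ∈ V with f j ≠ f i, (#(f j) : ℤ) =
      ∑ i ∈ V, ∑ j ∈ V with f j ≠ f i, (#(f i) : ℤ) := by
    simp only [sum_filter]
    rw [sum_comm]
    simp only [ne_comm]
  have h4 : ∑ i ∈ V, ∑ j ∈ V with f j ≠ f i, (#(f i) + #(f j) - 1 : ℤ) =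
      ∑ i ∈ V, (#(V.filter (f · ≠ f i)) : ℤ) * (2 * #(f i) - 1) := by
    simp only [sum_sub_distrib, sum_add_distrib, h3]
    simp only [sum_const, nsmul_eq_mul, ← sum_add_distrib, ← sum_sub_distrib]
    exact sum_congr rfl fun i _ => by ring
  have h5 : ∑ i ∈ V, (4 * #(f i) - 2 : ℤ) ≤
      ∑ i ∈ V, (#(V.filter (f · ≠ f i)) : ℤ) * (2 * #(f i) - 1) := by
    refine sum_le_sum fun i hi => ?_
    have ha := h i ((hV i).1 hi)
    have hb := ((hV i).1 hi).card_pos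
    zify at ha hb
    nlinarith
  rw [sum_sub_distrib, ← mul_sum, sum_const, nsmul_eq_mul] at h5
  have h6 : (#V : ℤ) ≤ Fintype.card ι := by exact_mod_cast card_le_univ V
  rw [h1]
  linarith

theorem two_mul_sum_minorCount_le [DecidableEq ι] (f : ι → Finset α) (s : Finset ι) (j : ι) (hj : j ∉ s) :
    2 * ∑ i ∈ s, minorCount (f i) (f j) ≤ ∑ i, ∑ k, minorCount (f i) (f k) := by
  have h1 : ∑ i ∈ insert j s, ∑ k, minorCount (f i) (f k) ≤ ∑ i, ∑ k, minorCount (f i) (f k) :=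
    sum_le_sum_of_subset_of_nonneg (subset_univ _)
      fun i _ _ => sum_nonneg fun j _ => minorCount_nonneg _ _
  rw [sum_insert hj] at h1
  have h2 : ∑ i ∈ s, minorCount (f i) (f j) ≤ ∑ i ∈ s, ∑ k, minorCount (f i) (f k) :=
    sum_le_sum fun i _ => single_le_sum (f := fun k => minorCount (f i) (f k))
      (fun k _ => minorCount_nonneg _ _) (mem_univ j)
  have h3 : ∑ i ∈ s, minorCount (f i) (f j) ≤ ∑ k, minorCount (f j) (f k) := by
    simp only [minorCount_comm _ (f j)]
    exact sum_le_sum_of_subset_of_nonneg (subset_univ _) fun k _ _ => minorCount_nonneg _ _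
  linarith

theorem four_mul_div_three_le_sum_minorCount [DecidableEq ι] [Fintype α] (f : ι → Finset α) {n m : ℕ}
    (hι : Fintype.card ι = n) (hα : Fintype.card α = n) (hf : ∑ i, #(f i) = m)
    (hm : 2 * n < m) (h3 : ¬ 3 ∣ m) (hmul : ∀ a b, a ≤ n → b ≤ n → a * b ≠ m) :
    4 * ((m / 3 : ℕ) : ℤ) ≤ ∑ i, ∑ j, minorCount (f i) (f j) := by
  by_cases h : ∀ i, (f i).Nonempty → 2 ≤ #{j | (f j).Nonempty ∧ f j ≠ f i}
  · have := sum_card_le_sum_minorCount f h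
    rw [hι, ← Nat.cast_sum, hf] at this
    omega
  push Not at h
  obtain ⟨i, hi, hc⟩ := h
  let V : Finset ι := {i | (f i).Nonempty}
  have hVm : ∑ j ∈ V, #(f j) = m := by
    rw [← hf]
    refine sum_subset (subset_univ V) fun j _ hj => ?_
    simpa [V] using hj
  have hVn : #V ≤ n := hι ▸ card_le_univ V
  have hs : ∀ s : Finset α, #s ≤ n := fun s => hα ▸ card_le_univ s
  rcases Nat.lt_succ_iff_lt_or_eq.1 hc with hc | hc
  · rw [Nat.lt_one_iff, card_eq_zero, filter_eq_empty_iff] at hc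
    refine absurd ?_ (hmul #V #(f i) hVn (hs _))
    rw [← hVm, ← smul_eq_mul, ← sum_const]
    refine sum_congr rfl fun j hj => ?_
    by_contra hne
    exact hc (mem_univ j) ⟨by simpa [V] using hj, fun h => hne (by rw [h])⟩
  · obtain ⟨j, hj⟩ := card_eq_one.1 hc
    have hjm : ∀ k, ((f k).Nonempty ∧ f k ≠ f i) ↔ k = j := fun k => by
      simpa using congrArg (k ∈ ·) hj
    obtain ⟨hj1, hj2⟩ := (hjm j).2 rfl
    have hjV : j ∈ V := by simpa [V] using hj1
    have heq : ∀ k ∈ V.erase j, f k = f i := by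
      intro k hk
      rw [mem_erase] at hk
      by_contra hne
      exact hk.1 ((hjm k).1 ⟨by simpa [V] using hk.2, hne⟩)
    refine le_trans ?_ (two_mul_sum_minorCount_le f (V.erase j) j (notMem_erase _ _))
    rw [sum_congr rfl fun k hk => by rw [heq k hk], sum_const, nsmul_eq_mul, minorCount_eq]
    have hM : #(V.erase j) + 1 = #V := card_erase_add_one hjV
    rw [← sum_erase_add _ _ hjV, sum_congr rfl fun k hk => by rw [heq k hk], sum_const,
      smul_eq_mul] at hVm
    have e1 := card_sdiff_add_card_inter (f i) (f j)
    have e2 := card_sdiff_add_card_inter (f j) (f i)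
    rw [inter_comm] at e2
    have e3 : #(f i \ f j) + #(f j \ f i) + #(f i ∩ f j) ≤ n := by
      have := hs (f i ∪ f j)
      have := card_union_add_card_inter (f i) (f j)
      omega
    have e4 : 0 < #(f i \ f j) + #(f j \ f i) := by
      by_contra! h
      apply hj2
      apply Subset.antisymm <;> rw [← sdiff_eq_empty_iff_subset, ← card_eq_zero] <;> omega
    have := two_mul_div_three_le (n := n) (m := m) (M := #(V.erase j)) (a := #(f i \ f j))
      (b := #(f j \ f i)) (c := #(f i ∩ f j)) (by rw [e1, e2, hVm]) hm (by omega) e3 h3 e4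
      (by rw [e2]; exact hj1.card_pos) (by rw [e1]; exact hi.card_pos)
    zify at this
    push_cast
    linarith
end

/-! ### Zero-one matrices as families of column supports -/

/-- The `0-1` matrix whose `j`-th column is the indicator of `f j`. -/
def supportMatrix {n : ℕ} (f : Fin n → Finset (Fin n)) : Matrix (Fin n) (Fin n) ℝ :=
  Matrix.of fun i j => if i ∈ f j then 1 else 0

section
variable {n : ℕ} (f : Fin n → Finset (Fin n))

theorem supportMatrix_apply (i j : Fin n) : supportMatrix f i j = if i ∈ f j then 1 else 0 := rfl

theorem supportMatrix_mem : supportMatrix f ∈ zeroOneMatrices n (∑ j, #(f j)) := by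
  refine ⟨fun i j => ?_, ?_⟩
  · rw [supportMatrix_apply]
    split_ifs <;> simp
  · have : {e : Fin n × Fin n | supportMatrix f e.1 e.2 = 1} =
        (univ.sigma f).map ⟨fun x => (x.2, x.1), fun x y h => by
          obtain ⟨x1, x2⟩ := x
          obtain ⟨y1, y2⟩ := y
          simp_all⟩ := by
      ext ⟨i, j⟩
      simp only [Set.mem_ofPred_eq, supportMatrix_apply, ite_eq_left_iff, zero_ne_one, imp_false,
        not_not, coe_map, Set.mem_image, mem_coe, mem_sigma, mem_univ, true_and]
      exact ⟨fun h => ⟨⟨j, i⟩, h, rfl⟩, by rintro ⟨⟨j, i⟩, h, ⟨⟩⟩; exact h⟩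
    rw [this, Set.ncard_coe_finset, card_map, card_sigma]

theorem exists_eq_supportMatrix {m : ℕ} {A : Matrix (Fin n) (Fin n) ℝ}
    (hA : A ∈ zeroOneMatrices n m) :
    ∃ f : Fin n → Finset (Fin n), ∑ j, #(f j) = m ∧ A = supportMatrix f := by
  classical
  have hAf : A = supportMatrix fun j => {i | A i j = 1} := by
    ext i j
    rw [supportMatrix_apply]
    rcases hA.1 i j with h | h <;> simp [h]
  refine ⟨_, ?_, hAf⟩
  rw [hAf] at hA
  exact (supportMatrix_mem _).2.symm.trans hA.2

theorem gram_supportMatrix (j k : Fin n) :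
    ((supportMatrix f).transpose * supportMatrix f) j k = #(f j ∩ f k) := by
  simp only [Matrix.mul_apply, Matrix.transpose_apply, supportMatrix_apply]

  simp only [ite_mul, one_mul, zero_mul, ← ite_and, ← mem_inter]
  rw [sum_boole, filter_mem_eq_inter, univ_inter]

theorem trace_gram_supportMatrix :
    ((supportMatrix f).transpose * supportMatrix f).trace = ((∑ j, #(f j) : ℕ) : ℝ) := by
  simp [Matrix.trace, gram_supportMatrix]

/-- The double sum runs over ordered pairs of columns, so it equals `2d`. -/
theorem trace_gram_sq_supportMatrix :
    ((supportMatrix f).transpose * supportMatrix f *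
      ((supportMatrix f).transpose * supportMatrix f)).trace =
      ((∑ j, #(f j) : ℕ) : ℝ) ^ 2 - ((∑ j, ∑ k, minorCount (f j) (f k) : ℤ) : ℝ) := by
  rw [Matrix.trace]
  simp only [Matrix.diag_apply, Matrix.mul_apply (M := _ * _), gram_supportMatrix, minorCount]
  push_cast
  simp only [sum_sub_distrib]
  rw [sq (∑ j, (#(f j) : ℝ)), sum_mul_sum, sub_sub_cancel]
  refine sum_congr rfl fun j _ => sum_congr rfl fun k _ => ?_
  rw [inter_comm (f k), sq]

variable {f}

theorem le_traceNorm_supportMatrix {m d : ℕ} (hm : ∑ j, #(f j) = m)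
    (hd : (2 * d : ℤ) ≤ ∑ j, ∑ k, minorCount (f j) (f k)) :
    √(m + 2 * √d) ≤ traceNorm (supportMatrix f) := by
  apply le_traceNorm
  · rw [trace_gram_supportMatrix, hm]
  · rw [trace_gram_sq_supportMatrix, hm]
    have : (2 * d : ℝ) ≤ ((∑ j, ∑ k, minorCount (f j) (f k) : ℤ) : ℝ) := by exact_mod_cast hd
    linarith

theorem traceNorm_supportMatrix {m d : ℕ} (hn : 2 ≤ n) (hm : ∑ j, #(f j) = m)
    (hd : ∑ j, ∑ k, minorCount (f j) (f k) = 2 * d) (hr : (supportMatrix f).rank ≤ 2) :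
    traceNorm (supportMatrix f) = √(m + 2 * √d) := by
  refine traceNorm_eq_of_rank_le_two _ ?_ ?_ hr hn
  · rw [trace_gram_supportMatrix, hm]
  · rw [trace_gram_sq_supportMatrix, hm, hd]
    push_cast
    ring

theorem exists_traceNorm_eq {m d : ℕ} (hn : 2 ≤ n) (P Q J K : Finset (Fin n)) (hJK : Disjoint J K)
    (hm : #J * #P + #K * #Q = m) (hd : #J * #K * minorCount P Q = d) :
    ∃ A ∈ zeroOneMatrices n m, traceNorm A = √(m + 2 * √d) := by
  let f : Fin n → Finset (Fin n) := fun j => if j ∈ J then P else if j ∈ K then Q else ∅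
  have hfsum : ∀ {R : Type} [CommRing R] (F : Finset (Fin n) → R), F ∅ = 0 →
      ∑ j, F (f j) = #J * F P + #K * F Q := by
    intro R _ F hF
    have : ∀ j, F (f j) = (if j ∈ J then F P else 0) + if j ∈ K then F Q else 0 := by
      intro j
      by_cases h1 : j ∈ J
      · simp [f, h1, disjoint_left.1 hJK h1]
      · by_cases h2 : j ∈ K <;> simp [f, h1, h2, hF]
    simp [this, sum_add_distrib]
  have hfm : ∑ j, #(f j) = m := by
    have := hfsum (fun s => (#s : ℤ)) (by simp)
    rw [← hm]
    exact_mod_cast this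
  have h0 : ∀ s : Finset (Fin n), minorCount s ∅ = 0 := fun s => by simp [minorCount]
  have hs : ∀ s : Finset (Fin n), minorCount s s = 0 := fun s => by simp [minorCount, sq]
  refine ⟨supportMatrix f, hfm ▸ supportMatrix_mem f, traceNorm_supportMatrix hn hfm ?_ ?_⟩
  · have h1 : ∀ j, ∑ k, minorCount (f j) (f k) = _ := fun j => hfsum (minorCount (f j)) (h0 _)
    simp only [h1]
    rw [hfsum (fun s => #J * minorCount s P + #K * minorCount s Q)
      (by simp [minorCount_comm ∅, h0]), minorCount_comm Q P, hs, hs, ← hd]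
    ring
  · have : supportMatrix f =
        (Matrix.of fun i => ![if i ∈ P then 1 else 0, if i ∈ Q then 1 else 0] :
          Matrix (Fin n) (Fin 2) ℝ) *
        (Matrix.of ![fun j => if j ∈ J then 1 else 0, fun j => if j ∈ K then 1 else 0] :
          Matrix (Fin 2) (Fin n) ℝ) := by
      ext i j
      rw [supportMatrix_apply, Matrix.mul_apply, Fin.sum_univ_two]
      by_cases h1 : j ∈ J
      · simp [f, h1, disjoint_left.1 hJK h1]
      · by_cases h2 : j ∈ K <;> simp [f, h1, h2]
    rw [this]
    exact (Matrix.rank_mul_le_left _ _).trans (Matrix.rank_le_width _)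

end

/-! ### Extremal matrices and the final theorem -/

theorem minTraceNorm_eq {n m : ℕ} {t : ℝ} (h : ∃ A ∈ zeroOneMatrices n m, traceNorm A = t)
    (h' : ∀ A ∈ zeroOneMatrices n m, t ≤ traceNorm A) : minTraceNorm n m = t := by
  refine IsLeast.csInf_eq ⟨h, ?_⟩
  rintro _ ⟨A, hA, rfl⟩
  exact h' A hA

theorem exists_traceNorm_eq_sqrt_mul {n a b : ℕ} (hn : 2 ≤ n) (ha : a ≤ n) (hb : b ≤ n) :
    ∃ A ∈ zeroOneMatrices n (a * b), traceNorm A = √(a * b : ℕ) := by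
  obtain ⟨J, -, hJ⟩ := exists_subset_card_eq (s := (univ : Finset (Fin n))) (n := a) (by simpa)
  obtain ⟨P, -, hP⟩ := exists_subset_card_eq (s := (univ : Finset (Fin n))) (n := b) (by simpa)
  simpa using exists_traceNorm_eq (m := a * b) (d := 0) hn P ∅ J ∅ (disjoint_empty_right J)
    (by simp [hJ, hP]) (by simp)

theorem exists_traceNorm_eq_sqrt_add {n m : ℕ} (hn : 3 ≤ n) (hm : m < 3 * n) (h3 : ¬ 3 ∣ m) :
    ∃ A ∈ zeroOneMatrices n m, traceNorm A = √(m + 2 * √(2 * (m / 3) : ℕ)) := by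
  obtain ⟨P, -, hP⟩ := exists_subset_card_eq (s := (univ : Finset (Fin n))) (n := 3) (by simpa)
  obtain ⟨Q, hQP, hQ⟩ := exists_subset_card_eq (s := P) (n := m % 3) (by omega)
  obtain ⟨J, -, hJ⟩ :=
    exists_subset_card_eq (s := (univ : Finset (Fin n))) (n := m / 3) (by simp; omega)
  obtain ⟨K, hKJ, hK⟩ := exists_subset_card_eq (s := Jᶜ) (n := 1) (by
    rw [card_compl, Fintype.card_fin]; omega)
  refine exists_traceNorm_eq (by omega) P Q J K
    (disjoint_of_subset_right hKJ disjoint_compl_right) (by rw [hJ, hP, hK, hQ]; omega) ?_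
  rw [hJ, hK, minorCount, inter_eq_right.2 hQP, hP, hQ]
  -- For either remainder `r`, the minor count `3 * r - r ^ 2` is `2`.
  have : m % 3 = 1 ∨ m % 3 = 2 := by omega
  rcases this with h | h <;> rw [h] <;> push_cast <;> ring

theorem exists_mul_eq_of_not_prime {n m : ℕ} (hm : 8 < m) (hm' : m ≤ 3 * n)
    (h : ¬ (m.Prime ∨ ∃ p : ℕ, p.Prime ∧ m = 2 * p)) : ∃ a b, a ≤ n ∧ b ≤ n ∧ m = a * b := by
  push Not at h
  obtain ⟨h1, h2⟩ := h
  -- If both factors are at least `3`, each is at most `m / 3 ≤ n`.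
  have key : ∀ a b, 3 ≤ a → 3 ≤ b → m = a * b → ∃ a b, a ≤ n ∧ b ≤ n ∧ m = a * b :=
    fun a b ha hb hab => ⟨a, b, by nlinarith, by nlinarith, hab⟩
  have split : ∀ k, 2 ≤ k → ¬ k.Prime → ∃ a b, 2 ≤ a ∧ 2 ≤ b ∧ k = a * b := by
    intro k hk hp
    obtain ⟨a, ha, ha2, hak⟩ := Nat.exists_dvd_of_not_prime2 hk hp
    obtain ⟨b, rfl⟩ := ha
    refine ⟨a, b, ha2, ?_, rfl⟩
    by_contra! hb
    interval_cases b <;> omega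
  have even : ∀ b, m = 2 * b → ∃ a b, a ≤ n ∧ b ≤ n ∧ m = a * b := by
    intro b hb
    obtain ⟨c, d, hc, hd, rfl⟩ := split b (by omega) fun hp => h2 b hp hb
    rcases hd.eq_or_lt with rfl | hd
    -- Here `m = 4 * c`, and `8 < m` forces `3 ≤ c`.
    · exact key 4 c (by omega) (by omega) (by omega)
    · exact key (2 * c) d (by omega) hd (by rw [hb, mul_assoc])
  obtain ⟨a, b, ha, hb, hab⟩ := split m (by omega) h1
  rcases ha.eq_or_lt with rfl | ha
  · exact even b hab
  rcases hb.eq_or_lt with rfl | hb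
  · exact even a (by omega)
  exact key a b ha hb hab

theorem mul_ne_of_dvd_two_mul_prime {n m p c : ℕ} (hp : p.Prime) (hc : c = 1 ∨ c = 2)
    (hmp : m = c * p) (hm : 2 * n < m) {a b : ℕ} (ha : a ≤ n) (hb : b ≤ n) : a * b ≠ m := by
  -- If `p` divides `y`, the cofactor `x` divides `c ≤ 2`, so `x * y ≤ 2 * n < m`.
  have key : ∀ x y, y ≤ n → x * y = m → ¬ p ∣ y := by
    rintro x y hx hxy ⟨d, rfl⟩
    have h1 : x * d = c := Nat.eq_of_mul_eq_mul_right hp.pos (by rw [← hmp, ← hxy]; ring)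
    have h2 : x ≤ 2 := (Nat.le_of_dvd (by omega) ⟨d, h1.symm⟩).trans (by omega)
    have := Nat.mul_le_mul h2 hx
    omega
  intro h
  rcases hp.dvd_mul.1 (h ▸ hmp ▸ dvd_mul_left p c : p ∣ a * b) with h1 | h1
  · exact key b a ha (by rw [mul_comm, h]) h1
  · exact key a b hb h h1

theorem theorem2 (n m : ℕ) (hn : 4 ≤ n) (hm : 2 * n < m) (hm' : m ≤ 3 * n) :
    ((m.Prime ∨ ∃ p : ℕ, p.Prime ∧ m = 2 * p) →
      minTraceNorm n m = √((m : ℝ) + 2 * √(2 * (⌊(m : ℝ) / 3⌋₊ : ℝ)))) ∧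
    (¬ (m.Prime ∨ ∃ p : ℕ, p.Prime ∧ m = 2 * p) →
      minTraceNorm n m = √(m : ℝ)) := by
  constructor
  · intro h
    have hcp : ∃ p c, p.Prime ∧ (c = 1 ∨ c = 2) ∧ m = c * p := by
      rcases h with h | ⟨p, hp, rfl⟩
      · exact ⟨m, 1, h, .inl rfl, (one_mul m).symm⟩
      · exact ⟨p, 2, hp, .inr rfl, rfl⟩
    obtain ⟨p, c, hp, hc, hmp⟩ := hcp
    have h3 : ¬ 3 ∣ m := by
      intro h3
      have : 3 ∣ p := by rcases hc with rfl | rfl <;> omega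
      have := (Nat.prime_dvd_prime_iff_eq Nat.prime_three hp).1 this
      subst this
      omega
    have hfloor : (2 * (⌊(m : ℝ) / 3⌋₊ : ℝ)) = ((2 * (m / 3) : ℕ) : ℝ) := by
      rw [Nat.floor_div_ofNat, Nat.floor_natCast]
      push_cast
      rfl
    rw [hfloor]
    refine minTraceNorm_eq (exists_traceNorm_eq_sqrt_add (by omega) (by omega) h3) ?_
    intro A hA
    obtain ⟨f, hf, rfl⟩ := exists_eq_supportMatrix hA
    refine le_traceNorm_supportMatrix hf ?_
    have := four_mul_div_three_le_sum_minorCount f (Fintype.card_fin n) (Fintype.card_fin n) hf hm h3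
      fun a b ha hb => mul_ne_of_dvd_two_mul_prime hp hc hmp hm ha hb
    push_cast at this ⊢
    linarith
  · intro h
    obtain ⟨a, b, ha, hb, rfl⟩ := exists_mul_eq_of_not_prime (by omega) hm' h
    refine minTraceNorm_eq (exists_traceNorm_eq_sqrt_mul (by omega) ha hb) ?_
    intro A hA
    obtain ⟨f, hf, rfl⟩ := exists_eq_supportMatrix hA
    simpa using le_traceNorm_supportMatrix (d := 0) hf
      (by simpa using sum_nonneg fun j _ => sum_nonneg fun k _ => minorCount_nonneg (f j) (f k))
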